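/- Let $\mathbb{F}_q$ be the finite field with $q$ elements. For a linear code $C\subseteq\mathbb{F}_q^n$ with minimum Hamming distance $d$, put $d(\mathbf v,C)=\min_{\mathbf x\in C}d(\mathbf v,\mathbf x)$, let $\rho=\max_{\mathbf v}d(\mathbf v,C)$ be its covering radius and let $B_{\mathbf v,t}$ be the number of codewords at Hamming distance exactly $t$ from $\mathbf v\in\mathbb{F}_q^n$. The code is *perfect* if $\lfloor (d-1)/2\rfloor=\rho$; *completely regular* (CR) if $B_{\mathbf v,t}$ depends only on $t$ and $d(\mathbf v,C)$; *uniformly packed in the wide sense* (UPWS) if there are rational numbers $\beta_0,\dots,\beta_\rho$ with $\sum_{i=0}^{\rho}\beta_iB_{\mathbf x,i}=1$ for all $\mathbf x\in\mathbb{F}_q^n$. An $[n,k,d]_q$ code is MDS if $d=n-k+1$, and is nontrivial if $2\le k\le n-2$. The *MDS conjecture over $\mathbb{F}_q$* says that every nontrivial MDS $[n,k,d]_q$ code has $n\le q+1$, unless $q$ is even and $k\in\{3,q-1\}$, in which case $n\le q+2$. **Theorem.** Let $C$ be a nontrivial MDS $[q+1,k,q-k+2]_q$ code (so $2\le k\le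 q-1$). 1. If $k=q-1$, then $C$ is a Hamming code (the columns of some parity check matrix represent each one-dimensional subspace of $\mathbb{F}_q^m$ exactly once, for some $m\ge 2$), and it is perfect and CR (and UPWS). 2. If $k=2$ and either $q$ is even or $q=3$, then $C$ is UPWS; if moreover $q=3$, then $C$ is also CR. 3. If $k=q-2$ and $q$ is even, then $C$ is UPWS. 4. In all other cases, assuming that the MDS conjecture over $\mathbb{F}_q$ is true, $C$ is not UPWS and not CR. Moreover, for every $q=2^m$ with $m>1$ there exists a CR $[q+1,q-2,4]_q$ code, namely the doubly-extended Reed–Solomon code $\{((p(a))_{a\in\mathbb{F}_q},\,p_{q-3}) : p=p_0+p_1X+\dots+p_{q-3}X^{q-3}\in\mathbb{F}_q[X]\}$. -/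

import Mathlib

namespace CodingTheory

variable {F ι : Type*} [Field F] [DecidableEq F] [Fintype ι]

/-- The minimum Hamming distance between distinct codewords of the linear code `C`. -/
noncomputable def minDist (C : Submodule F (ι → F)) : ℕ :=
  sInf {d : ℕ | ∃ x ∈ C, ∃ y ∈ C, x ≠ y ∧ hammingDist x y = d}

/-- The linear code `C` of length `n = |ι|` over `F` is an `[n, k, d]` code. -/
def IsLinearCode (C : Submodule F (ι → F)) (k d : ℕ) : Prop :=
  Module.finrank F C = k ∧ minDist C = d

/-- `C` is maximum distance separable: equality `d = n - k + 1` in the Singleton bound. -/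
def IsMDS (C : Submodule F (ι → F)) : Prop :=
  minDist C = Fintype.card ι - Module.finrank F C + 1

/-- The distance `d(v, C)` of a vector to the code. -/
noncomputable def distToCode (C : Submodule F (ι → F)) (v : ι → F) : ℕ :=
  sInf {d : ℕ | ∃ x ∈ C, hammingDist v x = d}

/-- The covering radius: the maximum over all vectors `v` of `d(v, C)`
(these distances are bounded by the length of the code). -/
noncomputable def coveringRadius (C : Submodule F (ι → F)) : ℕ :=
  ⨆ v : ι → F, distToCode C v

/-- The packing radius `⌊(d - 1) / 2⌋`. -/
noncomputable def packingRadius (C : Submodule F (ι → F)) : ℕ :=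
  (minDist C - 1) / 2

/-- `C` is perfect: packing radius and covering radius coincide. -/
def IsPerfect (C : Submodule F (ι → F)) : Prop :=
  packingRadius C = coveringRadius C

/-- `B_{v,t}`, the number of codewords at distance exactly `t` from `v`. -/
noncomputable def numAtDist (C : Submodule F (ι → F)) (v : ι → F) (t : ℕ) : ℕ :=
  {x : ι → F | x ∈ C ∧ hammingDist v x = t}.ncard

/-- `C` is completely regular: `B_{v,t}` depends only on `t` and `d(v, C)`. -/
def IsCompletelyRegular (C : Submodule F (ι → F)) : Prop :=
  ∀ u v : ι → F, distToCode C u = distToCode C v → ∀ t : ℕ, numAtDist C u t = numAtDist C v t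

/-- `C`, with covering radius `ρ`, is uniformly packed in the wide sense: there are rational
packing coefficients `β_0, …, β_ρ` with `∑_{i ≤ ρ} β_i B_{x,i} = 1` for every vector `x`. -/
def IsUPWS (C : Submodule F (ι → F)) : Prop :=
  ∃ β : ℕ → ℚ, ∀ x : ι → F,
    ∑ i ∈ Finset.range (coveringRadius C + 1), β i * (numAtDist C x i : ℚ) = 1

/-- `C` is a (`q`-ary) Hamming code: for some `m ≥ 2`, `C` is the set of all `x` with `H x = 0`
for a parity check matrix `H` with `m` rows whose columns `H i` are nonzero and represent every
one-dimensional subspace of `F ^ m` exactly once. -/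
def IsHammingCode (C : Submodule F (ι → F)) : Prop :=
  ∃ m : ℕ, 2 ≤ m ∧ ∃ H : ι → (Fin m → F),
    (∀ i, H i ≠ 0) ∧
    (∀ v : Fin m → F, v ≠ 0 → ∃! i, ∃ c : F, v = c • H i) ∧
    ∀ x : ι → F, x ∈ C ↔ ∑ i, x i • H i = 0

/-- The doubly-extended Reed–Solomon code of dimension `k` over `F`: its codewords are the vectors
`((p(a))_{a ∈ F}, p_{k-1})` for polynomials `p = p_0 + p_1 X + ⋯ + p_{k-1} X^{k-1}`. The
coordinates are labelled by `F ∪ {∞}` through `e`; `none` stands for `∞`. -/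
noncomputable def doublyExtendedRS (e : ι ≃ Option F) (k : ℕ) : Submodule F (ι → F) :=
  (Polynomial.degreeLT F k).map
    (LinearMap.pi fun i => (e i).elim (Polynomial.lcoeff F (k - 1)) Polynomial.leval)

/-- The MDS conjecture over the finite field `F` with `q` elements: a nontrivial MDS code of
length `n` and dimension `k` (`2 ≤ k ≤ n - 2`) has `n ≤ q + 1`, unless `q` is even and
`k = 3` or `k = q - 1`, in which case `n ≤ q + 2`. -/
def MDSConjecture (F : Type*) [Field F] [DecidableEq F] [Fintype F] : Prop :=
  ∀ (n k : ℕ) (C : Submodule F (Fin n → F)),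
    Module.finrank F C = k → IsMDS C → 2 ≤ k → k ≤ n - 2 →
      n ≤ Fintype.card F + 1 ∨
        (Even (Fintype.card F) ∧ (k = 3 ∨ k = Fintype.card F - 1) ∧ n ≤ Fintype.card F + 2)

end CodingTheory

set_option linter.unusedSectionVars false

namespace CodingTheory

open Finset

/-! ### Distances, covering radius and translation by codewords. -/

section Basic

variable {F ι : Type*} [Field F] [DecidableEq F] [Fintype ι]

/-! Let `n = q + 1`. In an MDS code any `k` coordinates form an information set, so the covering
radius `ρ` is at most `n - k`; everything turns on whether it equals `n - k`.

If `ρ = n - k`, double counting pairs (codeword, `k`-set on which it agrees with `v`) gives packing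
coefficients: each `k`-set is matched by exactly one codeword (`IsMDSOfDim.isUPWS`).

If `ρ < n - k` and `k + 1 < q`, no packing coefficients exist (`IsMDSOfDim.not_isUPWS`). They would
give a function `f` of the weight, supported on weights at most `ρ`, whose translates by the code
sum to `1`; such an `f` is uncorrelated with every nonzero dual word. Expand `f` in indicators of
"`z` vanishes on `T`" with coefficients depending on `#T`. Those with `#T ≤ k` vanish by the support
condition, the others by downward induction, since every larger set supports a dual word. Hence `f =
0`, a contradiction.

A vector at distance `n - k` extends the code to an MDS code of length `q + 2` and dimension `k +
1`. The MDS conjecture allows this only for `q` even and `k = 2` or `k = q - 2`. As complete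
regularity implies UPWS, this settles the negative part.

For `k = q - 1` the parity check columns are exactly the points of a projective line, so the code is
a Hamming code. For `k = 2` and `q` even, a conic supplies a vector at distance `n - 2`. For `k = q
- 2` and `q` even, a parity argument on words of weight `4` makes every such code completely
regular, which gives both UPWS and the Reed–Solomon example. -/

theorem card_agree_add_hammingDist (u v : ι → F) :
    #{i | u i = v i} + hammingDist u v = Fintype.card ι := by
  rw [hammingDist, card_filter_add_card_filter_not, card_univ]

theorem card_zeros_add_hammingNorm (u : ι → F) :
    #{i | u i = 0} + hammingNorm u = Fintype.card ι := by
  rw [hammingNorm, card_filter_add_card_filter_not, card_univ]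

theorem distToCode_le (C : Submodule F (ι → F)) (v : ι → F) {x : ι → F} (hx : x ∈ C) :
    distToCode C v ≤ hammingDist v x :=
  Nat.sInf_le ⟨x, hx, rfl⟩

theorem exists_hammingDist_eq_distToCode (C : Submodule F (ι → F)) (v : ι → F) :
    ∃ x ∈ C, hammingDist v x = distToCode C v :=
  Nat.sInf_mem (s := {d : ℕ | ∃ x ∈ C, hammingDist v x = d}) ⟨_, 0, C.zero_mem, rfl⟩

theorem distToCode_le_coveringRadius (C : Submodule F (ι → F)) (v : ι → F) :
    distToCode C v ≤ coveringRadius C := by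
  refine le_ciSup (f := distToCode C) ⟨Fintype.card ι, ?_⟩ v
  rintro _ ⟨u, rfl⟩
  exact (distToCode_le C u C.zero_mem).trans hammingDist_le_card_fintype

theorem coveringRadius_le {C : Submodule F (ι → F)} {r : ℕ} (h : ∀ v, distToCode C v ≤ r) :
    coveringRadius C ≤ r :=
  ciSup_le h

theorem hammingDist_add_right (u v c : ι → F) :
    hammingDist (u + c) (v + c) = hammingDist u v := by
  simp [hammingDist]

theorem hammingNorm_sub (u v : ι → F) : hammingNorm (u - v) = hammingDist u v := by
  simp [hammingDist, hammingNorm, sub_ne_zero]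

theorem numAtDist_add (C : Submodule F (ι → F)) (v : ι → F) {c : ι → F} (hc : c ∈ C) (t : ℕ) :
    numAtDist C (v + c) t = numAtDist C v t := by
  have : {x : ι → F | x ∈ C ∧ hammingDist (v + c) x = t} =
      (fun x => x + c) '' {x : ι → F | x ∈ C ∧ hammingDist v x = t} := by
    ext x
    simp only [Set.mem_ofPred_eq, Set.mem_image]
    constructor
    · rintro ⟨hx, h⟩
      refine ⟨x - c, ⟨C.sub_mem hx hc, ?_⟩, sub_add_cancel x c⟩
      rw [← h, ← hammingDist_add_right v (x - c) c, sub_add_cancel]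
    · rintro ⟨y, ⟨hy, h⟩, rfl⟩
      exact ⟨C.add_mem hy hc, by rw [hammingDist_add_right, h]⟩
  rw [numAtDist, this, Set.ncard_image_of_injective _ (add_left_injective c)]
  rfl

theorem numAtDist_eq_zero_of_lt {C : Submodule F (ι → F)} {v : ι → F} {t : ℕ}
    (h : t < distToCode C v) : numAtDist C v t = 0 := by
  have : {x : ι → F | x ∈ C ∧ hammingDist v x = t} = ∅ := by
    ext x
    simp only [Set.mem_ofPred_eq, Set.mem_empty_iff_false, iff_false, not_and]
    intro hx ht
    have := distToCode_le C v hx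
    omega
  rw [numAtDist, this, Set.ncard_empty]

theorem minDist_le_hammingNorm {C : Submodule F (ι → F)} {x : ι → F} (hx : x ∈ C) (h0 : x ≠ 0) :
    minDist C ≤ hammingNorm x :=
  Nat.sInf_le ⟨x, hx, 0, C.zero_mem, h0, hammingDist_zero_right x⟩

theorem exists_hammingNorm_eq_minDist {C : Submodule F (ι → F)} (hC : C ≠ ⊥) :
    ∃ x ∈ C, x ≠ 0 ∧ hammingNorm x = minDist C := by
  obtain ⟨z, hz, hz0⟩ := C.exists_mem_ne_zero_of_ne_bot hC
  obtain ⟨x, hx, y, hy, hxy, h⟩ :=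
    Nat.sInf_mem (s := {d : ℕ | ∃ x ∈ C, ∃ y ∈ C, x ≠ y ∧ hammingDist x y = d})
      ⟨_, z, hz, 0, C.zero_mem, hz0, rfl⟩
  refine ⟨x - y, C.sub_mem hx hy, sub_ne_zero.2 hxy, ?_⟩
  rw [hammingNorm_sub, h]; rfl

end Basic

/-! ### Counting codewords by distance; complete regularity implies UPWS. -/

section Finite

variable {F ι : Type*} [Field F] [Fintype F] [DecidableEq F] [Fintype ι]

open Classical in
/-- The codewords as a finset. -/
noncomputable def words (C : Submodule F (ι → F)) : Finset (ι → F) := {x | x ∈ C}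

@[simp]
theorem mem_words {C : Submodule F (ι → F)} {x : ι → F} : x ∈ words C ↔ x ∈ C := by
  simp [words]

theorem numAtDist_eq_card (C : Submodule F (ι → F)) (v : ι → F) (t : ℕ) :
    numAtDist C v t = #{x ∈ words C | hammingDist v x = t} := by
  rw [numAtDist, ← Set.ncard_coe_finset]
  congr 1
  ext x
  simp

theorem numAtDist_distToCode_pos (C : Submodule F (ι → F)) (v : ι → F) :
    0 < numAtDist C v (distToCode C v) := by
  obtain ⟨x, hx, h⟩ := exists_hammingDist_eq_distToCode C v
  rw [numAtDist_eq_card, card_pos]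
  exact ⟨x, by simp [hx, h]⟩

/-- A sum over codewords of a function of the distance to `v`, grouped by distance. -/
theorem sum_words_hammingDist (C : Submodule F (ι → F)) (v : ι → F) (g : ℕ → ℚ) :
    ∑ x ∈ words C, g (hammingDist v x) =
      ∑ i ∈ range (Fintype.card ι + 1), g i * (numAtDist C v i : ℚ) := by
  rw [← sum_fiberwise_of_maps_to (s := words C) (t := range (Fintype.card ι + 1))
    (g := fun x => hammingDist v x)
    (fun x _ => mem_range.2 (Nat.lt_succ_of_le hammingDist_le_card_fintype))]
  refine sum_congr rfl fun i _ => ?_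
  rw [sum_congr rfl (g := fun _ => g i) (fun x hx => by rw [(mem_filter.1 hx).2]), sum_const,
    numAtDist_eq_card, nsmul_eq_mul, mul_comm]

/-- Double counting of pairs of a codeword `x` and a `j`-set of coordinates on which `x` agrees with
`v`. -/
theorem sum_words_choose (C : Submodule F (ι → F)) (v : ι → F) (j : ℕ) :
    ∑ x ∈ words C, (Fintype.card ι - hammingDist v x).choose j =
      ∑ T ∈ powersetCard j (univ : Finset ι), #{x ∈ words C | ∀ i ∈ T, v i = x i} := by
  have h : ∀ x ∈ words C, (Fintype.card ι - hammingDist v x).choose j =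
      ∑ T ∈ powersetCard j (univ : Finset ι), if ∀ i ∈ T, v i = x i then 1 else 0 := by
    intro x _
    rw [← card_agree_add_hammingDist v x, Nat.add_sub_cancel, ← card_powersetCard, card_eq_sum_ones,
      ← sum_filter]
    refine sum_congr ?_ fun _ _ => rfl
    ext T
    simp only [mem_powersetCard, mem_filter, subset_iff, mem_univ, true_and]
    simp [and_comm]
  rw [sum_congr rfl h, sum_comm]
  simp

/-- A triangular system with nonzero diagonal is solvable. -/
theorem exists_triangular_solution (N : ℕ) (b : ℕ → ℕ → ℚ) (hlt : ∀ t i, i < t → b t i = 0)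
    (hdiag : ∀ t, b t t ≠ 0) :
    ∃ β : ℕ → ℚ, ∀ t ≤ N, ∑ i ∈ range (N + 1), β i * b t i = 1 := by
  -- Back substitution: `m` is the number of bottom rows already solved. Correcting `β` at `s = N -
  -- m` repairs row `s` and leaves the rows below unchanged.
  suffices H : ∀ m ≤ N + 1, ∃ β : ℕ → ℚ, ∀ t ≤ N, N + 1 ≤ t + m →
      ∑ i ∈ range (N + 1), β i * b t i = 1 by
    obtain ⟨β, h⟩ := H (N + 1) le_rfl
    exact ⟨β, fun t ht => h t ht (by omega)⟩
  intro m
  induction m with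
  | zero => exact fun _ => ⟨0, fun t ht h => by omega⟩
  | succ m ih =>
    intro hm
    obtain ⟨β, h⟩ := ih (by omega)
    set s := N - m with hs
    set c := (1 - ∑ i ∈ range (N + 1), β i * b s i) / b s s with hc
    have key : ∀ t, ∑ i ∈ range (N + 1), (β i + if i = s then c else 0) * b t i =
        ∑ i ∈ range (N + 1), β i * b t i + c * b t s := by
      intro t
      simp only [add_mul, sum_add_distrib, ite_mul, zero_mul, sum_ite_eq']
      rw [if_pos (mem_range.2 (by omega))]
    refine ⟨fun i => β i + if i = s then c else 0, fun t ht htm => ?_⟩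
    rw [key]
    rcases eq_or_ne t s with rfl | hne
    · rw [hc, div_mul_cancel₀ _ (hdiag _)]; ring
    · rw [hlt t s (by omega), mul_zero, add_zero]
      exact h t ht (by omega)

/-- The UPWS equations depend only on `distToCode C x`, and that system is triangular: no codeword
is nearer than the distance to the code, and some codeword attains it. -/
theorem IsCompletelyRegular.isUPWS {C : Submodule F (ι → F)} (hC : IsCompletelyRegular C) :
    IsUPWS C := by
  classical
  -- Distances that no vector attains get a row of the identity matrix, which keeps the diagonal
  -- nonzero.
  set b : ℕ → ℕ → ℚ := fun t i =>
    if h : ∃ x, distToCode C x = t then (numAtDist C h.choose i : ℚ) else if t = i then 1 else 0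
    with hb
  obtain ⟨β, h⟩ := exists_triangular_solution (coveringRadius C) b
    (fun t i hi => by
      simp only [hb]
      split_ifs with h1 h2
      · rw [numAtDist_eq_zero_of_lt (by rw [h1.choose_spec]; exact hi), Nat.cast_zero]
      · omega
      · rfl)
    (fun t => by
      simp only [hb]
      split_ifs with h1
      · have := numAtDist_distToCode_pos C h1.choose
        rw [h1.choose_spec] at this
        exact_mod_cast this.ne'
      · exact one_ne_zero)
  refine ⟨β, fun x => ?_⟩
  rw [← h _ (distToCode_le_coveringRadius C x)]
  refine sum_congr rfl fun i _ => ?_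
  have hx : ∃ y, distToCode C y = distToCode C x := ⟨x, rfl⟩
  simp only [hb, dif_pos hx]
  rw [hC _ _ hx.choose_spec]

end Finite

/-! ### MDS codes: information sets, packing coefficients, reduction of complete regularity. -/

section MDS

variable {F ι : Type*} [Field F] [DecidableEq F] [Fintype ι]

/-- `C` has dimension `k`, and its nonzero words have weight at least `n - k + 1`. -/
structure IsMDSOfDim (C : Submodule F (ι → F)) (k : ℕ) : Prop where
  finrank_eq : Module.finrank F C = k
  lt_hammingNorm : ∀ x ∈ C, x ≠ 0 → Fintype.card ι < hammingNorm x + k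

theorem IsLinearCode.isMDSOfDim {C : Submodule F (ι → F)} {k d : ℕ} (h : IsLinearCode C k d)
    (hd : Fintype.card ι < d + k) : IsMDSOfDim C k :=
  ⟨h.1, fun x hx h0 => by
    have := minDist_le_hammingNorm hx h0
    rw [h.2] at this
    omega⟩

namespace IsMDSOfDim

variable {C : Submodule F (ι → F)} {k : ℕ}

theorem le_card (h : IsMDSOfDim C k) : k ≤ Fintype.card ι := by
  rw [← h.finrank_eq, ← Module.finrank_fintype_fun_eq_card F]
  exact Submodule.finrank_le C

theorem eq_zero (h : IsMDSOfDim C k) {x : ι → F} (hx : x ∈ C) {S : Finset ι} (hS : k ≤ #S)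
    (h0 : ∀ i ∈ S, x i = 0) : x = 0 := by
  by_contra hne
  have h1 := h.lt_hammingNorm x hx hne
  have h2 := card_zeros_add_hammingNorm x
  have h3 : #S ≤ #{i | x i = 0} := card_le_card fun i hi => by simp [h0 i hi]
  omega

theorem eq_of_eqOn (h : IsMDSOfDim C k) {x y : ι → F} (hx : x ∈ C) (hy : y ∈ C) {S : Finset ι}
    (hS : k ≤ #S) (h0 : ∀ i ∈ S, x i = y i) : x = y :=
  sub_eq_zero.1 (h.eq_zero (C.sub_mem hx hy) hS fun i hi => by simp [h0 i hi])

/-- Any `k` coordinates form an information set. -/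
theorem exists_mem_eqOn (h : IsMDSOfDim C k) (S : Finset ι) (hS : #S ≤ k) (f : ι → F) :
    ∃ x ∈ C, ∀ i ∈ S, x i = f i := by
  obtain ⟨U, hSU, -, hU⟩ := exists_subsuperset_card_eq (subset_univ S) hS
    (by rw [card_univ]; exact h.le_card)
  -- Restriction to `k` coordinates is injective by the minimum weight, hence surjective by equality
  -- of dimensions.
  let r : C →ₗ[F] (U → F) := (LinearMap.funLeft F F (Subtype.val : U → ι)).comp C.subtype
  have hr : ∀ (x : C) (i : U), r x i = (x : ι → F) i := fun _ _ => rfl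
  have hinj : Function.Injective r := by
    rw [injective_iff_map_eq_zero]
    intro x hx
    refine Subtype.ext (h.eq_zero x.2 hU.ge fun i hi => ?_)
    exact congrFun hx ⟨i, hi⟩
  have hsurj : Function.Surjective r :=
    (LinearMap.injective_iff_surjective_of_finrank_eq_finrank
      (by rw [h.finrank_eq, Module.finrank_fintype_fun_eq_card, Fintype.card_coe, hU])).1 hinj
  obtain ⟨x, hx⟩ := hsurj fun i => f i
  exact ⟨x, x.2, fun i hi => congrFun hx ⟨i, hSU hi⟩⟩

theorem distToCode_le (h : IsMDSOfDim C k) (v : ι → F) : distToCode C v ≤ Fintype.card ι - k := by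
  obtain ⟨S, -, hS⟩ := exists_subset_card_eq (s := (univ : Finset ι)) (n := k)
    (by rw [card_univ]; exact h.le_card)
  obtain ⟨x, hx, hxv⟩ := h.exists_mem_eqOn S hS.le v
  refine (CodingTheory.distToCode_le C v hx).trans ?_
  have h1 := card_agree_add_hammingDist v x
  have h2 : #S ≤ #{i | v i = x i} := card_le_card fun i hi => by simp [hxv i hi]
  omega

/-- The singleton bound is attained. -/
theorem minDist_eq (h : IsMDSOfDim C k) (hk : 0 < k) : minDist C = Fintype.card ι - k + 1 := by
  classical
  obtain ⟨S, -, hS⟩ := exists_subset_card_eq (s := (univ : Finset ι)) (n := k)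
    (by rw [card_univ]; exact h.le_card)
  obtain ⟨s, hs⟩ := card_pos.1 (hS ▸ hk)
  -- A nonzero word with `k - 1` zeros on an information set has weight at most `n - k + 1`.
  obtain ⟨x, hx, hxs⟩ := h.exists_mem_eqOn S hS.le (Pi.single s 1)
  have hx0 : x ≠ 0 := fun h0 => by simpa [h0] using hxs s hs
  have h1 := card_zeros_add_hammingNorm x
  have h2 : #(S.erase s) ≤ #{i | x i = 0} := card_le_card fun i hi => by
    rw [mem_erase] at hi
    simp [hxs i hi.2, hi.1]
  rw [card_erase_of_mem hs] at h2
  have h3 := minDist_le_hammingNorm hx hx0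
  have hne : C ≠ ⊥ := fun hb => hx0 (by simpa [hb] using hx)
  obtain ⟨y, hy, hy0, hym⟩ := exists_hammingNorm_eq_minDist hne
  have h4 := h.lt_hammingNorm y hy hy0
  have := h.le_card
  omega

theorem isLinearCode (h : IsMDSOfDim C k) (hk : 0 < k) :
    IsLinearCode C k (Fintype.card ι - k + 1) :=
  ⟨h.finrank_eq, h.minDist_eq hk⟩

variable [Fintype F]

/-- The number of codewords agreeing with `u` on at most `k` coordinates does not depend on `u`. -/
theorem card_eqOn_eq (h : IsMDSOfDim C k) (T : Finset ι) (hT : #T ≤ k) (u v : ι → F) :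
    #{x ∈ words C | ∀ i ∈ T, u i = x i} = #{x ∈ words C | ∀ i ∈ T, v i = x i} := by
  obtain ⟨c, hc, hcT⟩ := h.exists_mem_eqOn T hT (v - u)
  refine card_bij (fun x _ => x + c) ?_ (fun x _ y _ hxy => add_left_injective c hxy) ?_
  · intro x hx
    simp only [mem_filter, mem_words] at hx ⊢
    exact ⟨C.add_mem hx.1 hc, fun i hi => by simp [hcT i hi, hx.2 i hi]⟩
  · intro y hy
    simp only [mem_filter, mem_words] at hy
    refine ⟨y - c, ?_, sub_add_cancel y c⟩
    simp only [mem_filter, mem_words]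
    exact ⟨C.sub_mem hy.1 hc, fun i hi => by simp [hcT i hi, ← hy.2 i hi]⟩

theorem card_eqOn_eq_one (h : IsMDSOfDim C k) (T : Finset ι) (hT : #T = k) (u : ι → F) :
    #{x ∈ words C | ∀ i ∈ T, u i = x i} = 1 := by
  obtain ⟨c, hc, hcT⟩ := h.exists_mem_eqOn T hT.le u
  rw [card_eq_one]
  refine ⟨c, ?_⟩
  ext x
  simp only [mem_filter, mem_words, mem_singleton]
  constructor
  · rintro ⟨hx, hxT⟩
    exact h.eq_of_eqOn hx hc hT.ge fun i hi => by rw [hcT i hi, hxT i hi]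
  · rintro rfl
    exact ⟨hc, fun i hi => (hcT i hi).symm⟩

/-- An MDS code whose covering radius is as large as possible is uniformly packed. -/
theorem isUPWS (h : IsMDSOfDim C k) (hρ : Fintype.card ι - k ≤ coveringRadius C) : IsUPWS C := by
  have hρ' : coveringRadius C = Fintype.card ι - k := le_antisymm (coveringRadius_le h.distToCode_le) hρ
  have hk := h.le_card
  have hpos : ((Fintype.card ι).choose k : ℚ) ≠ 0 := by exact_mod_cast (Nat.choose_pos hk).ne'
  -- A codeword at distance `i` from `v` agrees with it on `(n - i).choose k` of the `k`-sets. This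
  -- vanishes for `i > n - k`, so truncating the sum at the covering radius loses nothing.
  refine ⟨fun i => ((Fintype.card ι - i).choose k : ℚ) / (Fintype.card ι).choose k, fun v => ?_⟩
  have h1 := sum_words_choose C v k
  rw [sum_congr rfl (g := fun _ => 1)
    (fun T hT => h.card_eqOn_eq_one T (mem_powersetCard.1 hT).2 v)] at h1
  simp only [sum_const, card_powersetCard, card_univ, smul_eq_mul, mul_one] at h1
  have h2 := sum_words_hammingDist C v fun i => ((Fintype.card ι - i).choose k : ℚ)
  have h3 : ∑ x ∈ words C, ((Fintype.card ι - hammingDist v x).choose k : ℚ) =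
      (Fintype.card ι).choose k := by exact_mod_cast h1
  rw [h3] at h2
  simp only [div_mul_eq_mul_div]
  rw [← sum_div, div_eq_one_iff_eq hpos, h2]
  refine sum_subset (range_subset_range.2 (by omega)) fun i hi' hi => ?_
  rw [mem_range] at hi hi'
  rw [Nat.choose_eq_zero_of_lt (by omega), Nat.cast_zero, zero_mul]

/-- For an MDS code, complete regularity only has to be tested at distances below `n - k`. -/
theorem isCompletelyRegular (h : IsMDSOfDim C k)
    (hC : ∀ u v : ι → F, distToCode C u = distToCode C v →
      ∀ t < Fintype.card ι - k, numAtDist C u t = numAtDist C v t) : IsCompletelyRegular C := by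
  intro u v huv
  have hk := h.le_card
  set n := Fintype.card ι with hn
  -- The first `k + 1` binomial moments of the distance distribution do not depend on the vector.
  have hsum : ∀ j ≤ k, ∑ i ∈ range (n + 1), ((n - i).choose j : ℚ) *
      ((numAtDist C u i : ℚ) - numAtDist C v i) = 0 := by
    intro j hj
    simp only [mul_sub, sum_sub_distrib]
    rw [← sum_words_hammingDist C u fun i => ((n - i).choose j : ℚ),
      ← sum_words_hammingDist C v fun i => ((n - i).choose j : ℚ), sub_eq_zero]
    have := (sum_words_choose C u j).trans ((sum_congr rfl fun T hT =>
      h.card_eqOn_eq T (by rw [(mem_powersetCard.1 hT).2]; exact hj) u v).trans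
        (sum_words_choose C v j).symm)
    exact_mod_cast this
  intro t
  induction t using Nat.strong_induction_on with
  | _ t ih =>
    rcases lt_or_ge t (n - k) with ht | ht
    · exact hC u v huv t ht
    rcases lt_or_ge n t with htn | htn
    · have : ∀ w : ι → F, numAtDist C w t = 0 := fun w => by
        rw [numAtDist_eq_card, card_eq_zero, filter_eq_empty_iff]
        intro x _ hx
        have : hammingDist w x ≤ Fintype.card ι := hammingDist_le_card_fintype
        omega
      rw [this, this]
    -- The moment of order `n - t` has coefficient `1` at `t` and `0` beyond it, so it determines
    -- the count at `t` from the smaller ones.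
    have := hsum (n - t) (by omega)
    rw [sum_eq_single t, Nat.choose_self, Nat.cast_one, one_mul, sub_eq_zero] at this
    · exact_mod_cast this
    · intro i hi hit
      rw [mem_range] at hi
      rcases lt_or_gt_of_ne hit with hlt | hgt
      · rw [ih i hlt, sub_self, mul_zero]
      · rw [Nat.choose_eq_zero_of_lt (by omega), Nat.cast_zero, zero_mul]
    · intro hnot
      exact absurd (mem_range.2 (by omega)) hnot

end IsMDSOfDim

end MDS

/-! ### Codimension two: Hamming codes. -/

namespace IsMDSOfDim

variable {F ι : Type*} [Field F] [Fintype F] [DecidableEq F] [Fintype ι]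
  {C : Submodule F (ι → F)} {k : ℕ}

theorem eq_of_hammingDist_le (h : IsMDSOfDim C k) {v x y : ι → F} (hx : x ∈ C) (hy : y ∈ C)
    (hxy : hammingDist v x + hammingDist v y + k ≤ Fintype.card ι) : x = y := by
  by_contra hne
  have h1 := h.lt_hammingNorm _ (C.sub_mem hx hy) (sub_ne_zero.2 hne)
  rw [hammingNorm_sub] at h1
  have h2 := hammingDist_triangle x v y
  rw [hammingDist_comm x v] at h2
  omega

/-- A codeword at distance `t` and a nearest codeword are at most `n - k` apart, below the minimum
distance, so they coincide. -/
theorem numAtDist_eq_ite (h : IsMDSOfDim C k) {v : ι → F} {t : ℕ}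
    (ht : distToCode C v + t + k ≤ Fintype.card ι) :
    numAtDist C v t = if t = distToCode C v then 1 else 0 := by
  obtain ⟨y, hy, hyd⟩ := exists_hammingDist_eq_distToCode C v
  have huniq : ∀ x ∈ C, hammingDist v x = t → x = y := fun x hx hxt =>
    h.eq_of_hammingDist_le hx hy (v := v) (by omega)
  rw [numAtDist_eq_card]
  split_ifs with hts
  · rw [card_eq_one]
    refine ⟨y, ?_⟩
    ext x
    simp only [mem_filter, mem_words, mem_singleton]
    exact ⟨fun hx => huniq x hx.1 hx.2, fun hx => by rw [hx, hyd, hts]; exact ⟨hy, rfl⟩⟩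
  · rw [card_eq_zero, filter_eq_empty_iff]
    intro x hx hxt
    rw [mem_words] at hx
    rw [huniq x hx hxt] at hxt
    omega

/-- A parity check map of an MDS code with `n - k = 2`. -/
theorem exists_parityCheck (h : IsMDSOfDim C k) (hn : Fintype.card ι = k + 2) :
    ∃ φ : (ι → F) →ₗ[F] (Fin 2 → F), LinearMap.ker φ = C := by
  have h1 := C.finrank_quotient_add_finrank
  rw [h.finrank_eq, Module.finrank_fintype_fun_eq_card, hn] at h1
  have e : ((ι → F) ⧸ C) ≃ₗ[F] (Fin 2 → F) :=
    LinearEquiv.ofFinrankEq _ _ (by rw [Module.finrank_fintype_fun_eq_card, Fintype.card_fin]; omega)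
  refine ⟨e.toLinearMap.comp C.mkQ, ?_⟩
  rw [LinearEquiv.ker_comp, Submodule.ker_mkQ]

/-- Distinct columns of a parity check matrix are not proportional. -/
theorem smul_column_ne [DecidableEq ι] (h : IsMDSOfDim C k) (hn : Fintype.card ι = k + 2)
    {φ : (ι → F) →ₗ[F] (Fin 2 → F)} (hφ : LinearMap.ker φ = C) {i j : ι} (hij : i ≠ j) {a b : F}
    (ha : a ≠ 0) : a • φ (Pi.single i 1) ≠ b • φ (Pi.single j 1) := by
  intro heq
  -- Proportional columns would yield a nonzero codeword of weight at most `2`. The scalar `b` may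
  -- be `0`, so this also shows that columns are nonzero.
  have hmem : Pi.single i a - Pi.single j b ∈ C := by
    rw [← hφ, LinearMap.mem_ker, map_sub, sub_eq_zero]
    simpa only [← map_smul, ← Pi.single_smul, smul_eq_mul, mul_one] using heq
  have h0 := h.eq_zero hmem (S := univ \ {i, j})
    (by rw [card_sdiff_of_subset (subset_univ _), card_univ, card_pair hij]; omega)
    (fun l hl => by
      simp only [mem_sdiff, mem_univ, true_and, mem_insert, mem_singleton, not_or] at hl
      simp [hl.1, hl.2])
  apply ha
  simpa [hij] using congrFun h0 i

/-- The columns of a parity check matrix represent all points of the projective line. -/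
theorem exists_eq_smul_column [DecidableEq ι] (h : IsMDSOfDim C k) (hn : Fintype.card ι = k + 2)
    (hq : Fintype.card ι = Fintype.card F + 1)
    {φ : (ι → F) →ₗ[F] (Fin 2 → F)} (hφ : LinearMap.ker φ = C) {v : Fin 2 → F} (hv : v ≠ 0) :
    ∃ i, ∃ c : F, v = c • φ (Pi.single i 1) := by
  have hι : 1 < Fintype.card ι := by omega
  have hne : ∀ i, φ (Pi.single i 1) ≠ 0 := fun i h0 => by
    obtain ⟨j, hj⟩ := Fintype.exists_ne_of_one_lt_card hι i
    exact h.smul_column_ne hn hφ hj.symm (one_ne_zero (α := F)) (b := 0) (by simp [h0])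
  -- Nonzero multiples of the columns are distinct, and `(q + 1)(q - 1) = q ^ 2 - 1` counts all
  -- nonzero vectors of the plane.
  let g : ι × Fˣ → {v : Fin 2 → F // v ≠ 0} := fun p =>
    ⟨(p.2 : F) • φ (Pi.single p.1 1), smul_ne_zero p.2.ne_zero (hne p.1)⟩
  have hinj : Function.Injective g := by
    rintro ⟨i, a⟩ ⟨j, b⟩ hab
    have hab' : (a : F) • φ (Pi.single i 1) = (b : F) • φ (Pi.single j 1) := congrArg Subtype.val hab
    obtain rfl : i = j := by
      by_contra hij
      exact h.smul_column_ne hn hφ hij a.ne_zero hab'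
    rw [Units.ext (smul_left_injective F (hne i) hab')]
  have hcard : Fintype.card (ι × Fˣ) = Fintype.card {v : Fin 2 → F // v ≠ 0} := by
    rw [Fintype.card_prod, Fintype.card_units, hq, Fintype.card_subtype_compl,
      Fintype.card_subtype_eq, Fintype.card_fun, Fintype.card_fin]
    obtain ⟨r, hr⟩ := Nat.exists_eq_add_of_lt (Fintype.card_pos (α := F))
    rw [hr]
    have : (0 + r + 1) ^ 2 = (0 + r + 1 + 1) * r + 1 := by ring
    rw [this, Nat.add_sub_cancel, Nat.zero_add, Nat.add_sub_cancel]
  obtain ⟨⟨i, a⟩, hia⟩ := ((Fintype.bijective_iff_injective_and_card g).2 ⟨hinj, hcard⟩).2 ⟨v, hv⟩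
  exact ⟨i, a, (congrArg Subtype.val hia).symm⟩

theorem isHammingCode (h : IsMDSOfDim C k) (hn : Fintype.card ι = k + 2)
    (hq : Fintype.card ι = Fintype.card F + 1) : IsHammingCode C := by
  classical
  obtain ⟨φ, hφ⟩ := h.exists_parityCheck hn
  have hι : 1 < Fintype.card ι := by omega
  refine ⟨2, le_rfl, fun i => φ (Pi.single i 1), fun i h0 => ?_, fun v hv => ?_, fun x => ?_⟩
  · obtain ⟨j, hj⟩ := Fintype.exists_ne_of_one_lt_card hι i
    exact h.smul_column_ne hn hφ hj.symm (one_ne_zero (α := F)) (b := 0) (by simp [h0])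
  · obtain ⟨i, c, hc⟩ := h.exists_eq_smul_column hn hq hφ hv
    refine ⟨i, ⟨c, hc⟩, ?_⟩
    rintro j ⟨b, hb⟩
    by_contra hji
    refine h.smul_column_ne hn hφ hji (a := b) (b := c) ?_ (hb.symm.trans hc)
    rintro rfl
    exact hv (by rw [hb, zero_smul])
  · rw [← hφ, LinearMap.mem_ker]
    conv_lhs => rw [← univ_sum_single x, map_sum]
    refine Eq.congr (sum_congr rfl fun i _ => ?_) rfl
    rw [← map_smul, ← Pi.single_smul, smul_eq_mul, mul_one]

/-- Every syndrome is a multiple of a column, so changing one coordinate reaches the code; the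
radius is not `0` because the code is a proper subspace. -/
theorem coveringRadius_eq_one (h : IsMDSOfDim C k) (hn : Fintype.card ι = k + 2)
    (hq : Fintype.card ι = Fintype.card F + 1) : coveringRadius C = 1 := by
  classical
  obtain ⟨φ, hφ⟩ := h.exists_parityCheck hn
  apply le_antisymm
  · refine coveringRadius_le fun v => ?_
    by_cases hv : φ v = 0
    · have : v ∈ C := by rwa [← hφ, LinearMap.mem_ker]
      exact (CodingTheory.distToCode_le C v this).trans (by simp)
    · obtain ⟨i, c, hc⟩ := h.exists_eq_smul_column hn hq hφ hv
      have hmem : v - Pi.single i c ∈ C := by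
        rw [← hφ, LinearMap.mem_ker, map_sub, hc, ← map_smul, ← Pi.single_smul, smul_eq_mul,
          mul_one, sub_self]
      refine (CodingTheory.distToCode_le C v hmem).trans ?_
      rw [← hammingNorm_sub, sub_sub_cancel, hammingNorm, card_le_one_iff]
      intro a b ha hb
      simp only [mem_filter, mem_univ, true_and, ne_eq, Pi.single_apply, ite_eq_right_iff,
        not_forall] at ha hb
      rw [ha.1, hb.1]
  · by_contra hlt
    have hall : ∀ v, v ∈ C := fun v => by
      have h1 := distToCode_le_coveringRadius C v
      obtain ⟨x, hx, hd⟩ := exists_hammingDist_eq_distToCode C v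
      have h2 : hammingDist v x = 0 := by omega
      rw [hammingDist_eq_zero] at h2
      rwa [h2]
    have htop : C = ⊤ := eq_top_iff.2 fun v _ => hall v
    have := h.finrank_eq
    rw [htop, finrank_top, Module.finrank_fintype_fun_eq_card] at this
    omega

theorem isPerfect (h : IsMDSOfDim C k) (hk : 0 < k) (hn : Fintype.card ι = k + 2)
    (hq : Fintype.card ι = Fintype.card F + 1) : IsPerfect C := by
  rw [IsPerfect, h.coveringRadius_eq_one hn hq, packingRadius, h.minDist_eq hk, hn,
    Nat.add_sub_cancel_left]

theorem isCompletelyRegular_of_codim_two (h : IsMDSOfDim C k) (hn : Fintype.card ι = k + 2)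
    (hq : Fintype.card ι = Fintype.card F + 1) : IsCompletelyRegular C := by
  refine h.isCompletelyRegular fun u v huv t ht => ?_
  have hu := distToCode_le_coveringRadius C u
  rw [h.coveringRadius_eq_one hn hq] at hu
  rw [h.numAtDist_eq_ite (by omega), h.numAtDist_eq_ite (by omega), huv]

end IsMDSOfDim

/-! ### Codimension three, via words of weight four; dimension two, via a conic. -/

namespace IsMDSOfDim

variable {F ι : Type*} [Field F] [Fintype F] [DecidableEq F] [Fintype ι] [DecidableEq ι]
  {C : Submodule F (ι → F)} {k : ℕ}

/-- The codewords of weight `4` with prescribed values at `i` and `j`. -/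
noncomputable def quads (C : Submodule F (ι → F)) (i j : ι) (a b : F) : Finset (ι → F) :=
  {y ∈ words C | y i = a ∧ y j = b ∧ hammingNorm y = 4}

theorem card_support_sdiff_pair {y : ι → F} {i j : ι} (hij : i ≠ j) (hi : y i ≠ 0) (hj : y j ≠ 0)
    (hy : hammingNorm y = 4) : #(({l | y l ≠ 0} : Finset ι) \ {i, j}) = 2 := by
  rw [card_sdiff_of_subset, card_pair hij]
  · rw [hammingNorm] at hy
    omega
  · intro l hl
    rw [mem_insert, mem_singleton] at hl
    rcases hl with rfl | rfl <;> simpa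

/-- Outside `{i, j}` the supports are pairs in a set of `k + 1` coordinates. They are disjoint: two
words with overlapping pairs would agree on at least `k` coordinates. -/
theorem two_mul_card_quads_le (h : IsMDSOfDim C k) (hn : Fintype.card ι = k + 3) {i j : ι}
    (hij : i ≠ j) {a b : F} (ha : a ≠ 0) (hb : b ≠ 0) : 2 * #(quads C i j a b) ≤ k + 1 := by
  have hmem : ∀ y ∈ quads C i j a b, y ∈ C ∧ y i = a ∧ y j = b ∧ hammingNorm y = 4 := fun y hy => by
    simpa [quads] using hy
  have h2 : ∀ y ∈ quads C i j a b, #(({l | y l ≠ 0} : Finset ι) \ {i, j}) = 2 := fun y hy => by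
    obtain ⟨-, h1, h2, h3⟩ := hmem y hy
    exact card_support_sdiff_pair hij (h1 ▸ ha) (h2 ▸ hb) h3
  have hdisj : ∀ y ∈ quads C i j a b, ∀ y' ∈ quads C i j a b, y ≠ y' →
      Disjoint (({l | y l ≠ 0} : Finset ι) \ {i, j}) (({l | y' l ≠ 0} : Finset ι) \ {i, j}) := by
    intro y hy y' hy' hne
    by_contra hnd
    apply hne
    set A := ({l | y l ≠ 0} : Finset ι) \ {i, j} with hA
    set A' := ({l | y' l ≠ 0} : Finset ι) \ {i, j} with hA'
    have hcard := card_union_add_card_inter A A'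
    have hpos : 0 < #(A ∩ A') := card_pos.2 (not_disjoint_iff_nonempty_inter.1 hnd)
    rw [h2 y hy, h2 y' hy'] at hcard
    refine h.eq_of_eqOn (hmem y hy).1 (hmem y' hy').1 (S := univ \ (A ∪ A')) ?_ ?_
    · rw [card_sdiff_of_subset (subset_univ _), card_univ]
      omega
    · intro l hl
      obtain ⟨-, h1, h2, -⟩ := hmem y hy
      obtain ⟨-, h1', h2', -⟩ := hmem y' hy'
      by_cases hli : l = i
      · rw [hli, h1, h1']
      by_cases hlj : l = j
      · rw [hlj, h2, h2']
      simp [hA, hA', hli, hlj] at hl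
      rw [hl.1, hl.2]
  have h3 := card_biUnion hdisj
  rw [sum_congr rfl h2, sum_const, smul_eq_mul] at h3
  have h4 : #((quads C i j a b).biUnion fun y => ({l | y l ≠ 0} : Finset ι) \ {i, j}) ≤
      #((univ : Finset ι) \ {i, j}) :=
    card_le_card (biUnion_subset.2 fun y _ => sdiff_subset_sdiff (subset_univ _) Subset.rfl)
  rw [card_sdiff_of_subset (subset_univ _), card_univ, card_pair hij] at h4
  omega

/-- Every four coordinates support a codeword. -/
theorem exists_quad (h : IsMDSOfDim C k) (hn : Fintype.card ι = k + 3) {P : Finset ι}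
    (hP : #P = 4) {i : ι} (hi : i ∈ P) {a : F} (ha : a ≠ 0) :
    ∃ y ∈ C, y i = a ∧ ({l | y l ≠ 0} : Finset ι) = P := by
  have hS : #(insert i (univ \ P)) = k := by
    rw [card_insert_of_notMem (by simpa using hi), card_sdiff_of_subset (subset_univ _), card_univ]
    have := h.le_card
    have h4 := card_le_univ P
    omega
  obtain ⟨y, hy, hyS⟩ := h.exists_mem_eqOn _ hS.le (Pi.single i a)
  have hyi : y i = a := by simpa using hyS i (mem_insert_self _ _)
  refine ⟨y, hy, hyi, eq_of_subset_of_card_le ?_ ?_⟩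
  · intro l hl
    by_contra hlP
    have hli : l ≠ i := fun hli => hlP (hli ▸ hi)
    have := hyS l (by simp [hlP])
    simp [hli] at this
    simp [this] at hl
  · have := h.lt_hammingNorm y hy fun h0 => ha (by rw [← hyi, h0]; rfl)
    rw [hammingNorm] at this
    omega

/-- Each pair of coordinates outside `{i, j}` completes `{i, j}` to the support of a word with value
`a` at `i`, and different pairs give different words. -/
theorem choose_le_sum_card_quads (h : IsMDSOfDim C k) (hn : Fintype.card ι = k + 3) {i j : ι}
    (hij : i ≠ j) {a : F} (ha : a ≠ 0) :
    (k + 1).choose 2 ≤ ∑ b ∈ univ.erase (0 : F), #(quads C i j a b) := by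
  set Y : Finset (ι → F) := {y ∈ words C | y i = a ∧ y j ≠ 0 ∧ hammingNorm y = 4} with hY
  have h1 : #Y = ∑ b ∈ univ.erase (0 : F), #(quads C i j a b) := by
    rw [card_eq_sum_card_fiberwise (f := fun y => y j) (t := univ.erase (0 : F))
      (fun y hy => by simp [hY] at hy; simp [hy.2.2.1])]
    refine sum_congr rfl fun b hb => congrArg _ ?_
    ext y
    simp only [hY, quads, mem_filter, mem_words]
    constructor
    · rintro ⟨⟨h1, h2, -, h4⟩, h5⟩
      exact ⟨h1, h2, h5, h4⟩
    · rintro ⟨h1, h2, rfl, h4⟩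
      exact ⟨⟨h1, h2, (mem_erase.1 hb).1, h4⟩, rfl⟩
  have hR : #((univ : Finset ι) \ {i, j}) = k + 1 := by
    rw [card_sdiff_of_subset (subset_univ _), card_univ, card_pair hij]
    omega
  rw [← h1, ← hR, ← card_powersetCard]
  refine (card_le_card ?_).trans
    (card_image_le (s := Y) (f := fun y => ({l | y l ≠ 0} : Finset ι) \ {i, j}))
  intro P hP
  rw [mem_powersetCard] at hP
  have hd : Disjoint P {i, j} := disjoint_of_subset_left hP.1 sdiff_disjoint
  obtain ⟨y, hy, hyi, hyP⟩ := h.exists_quad hn (P := P ∪ {i, j}) (i := i) (a := a)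
    (by rw [card_union_of_disjoint hd, hP.2, card_pair hij]) (by simp) ha
  refine mem_image.2 ⟨y, ?_, ?_⟩
  · simp only [hY, mem_filter, mem_words]
    refine ⟨hy, hyi, ?_, ?_⟩
    · have : j ∈ ({l | y l ≠ 0} : Finset ι) := by rw [hyP]; simp
      simpa using this
    · rw [hammingNorm, hyP, card_union_of_disjoint hd, hP.2, card_pair hij]
  · simp only [hyP]
    rw [union_sdiff_right, sdiff_eq_self_of_disjoint hd]

/-- For `k` even the disjoint pairs miss a coordinate, so each of the `q - 1 = k + 1` values of `b`
accounts for at most `k / 2` words. The total is at least `(k + 1) * k / 2`, which forces equality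
throughout. -/
theorem two_mul_card_quads (h : IsMDSOfDim C k) (hn : Fintype.card ι = k + 3)
    (hq : Fintype.card ι = Fintype.card F + 1) (heven : Even k) {i j : ι} (hij : i ≠ j)
    {a b : F} (ha : a ≠ 0) (hb : b ≠ 0) : 2 * #(quads C i j a b) = k := by
  have hle : ∀ b ∈ univ.erase (0 : F), 2 * #(quads C i j a b) ≤ k := fun b hb => by
    have := h.two_mul_card_quads_le hn hij ha (mem_erase.1 hb).1
    obtain ⟨r, hr⟩ := heven
    omega
  have hsum : ∑ b ∈ univ.erase (0 : F), 2 * #(quads C i j a b) = ∑ b ∈ univ.erase (0 : F), k := by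
    apply le_antisymm (sum_le_sum hle)
    rw [sum_const, card_erase_of_mem (mem_univ _), card_univ, ← mul_sum, smul_eq_mul]
    have h1 := h.choose_le_sum_card_quads hn hij ha
    have h3 : (k + 1) * k = (k + 1).choose 2 * 2 := by
      rw [Nat.choose_two_right]
      exact (Nat.div_mul_cancel (Nat.even_mul_pred_self (k + 1)).two_dvd).symm
    have h4 : Fintype.card F - 1 = k + 1 := by omega
    rw [h4, h3]
    omega
  exact (sum_eq_sum_iff_of_le hle).1 hsum b (by simp [hb])

/-- A nonzero codeword has weight at least `4`, so at distance `2` from `z` it must keep both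
entries of `z` and have just two more nonzero ones. The extra `1` counts the zero word. -/
theorem numAtDist_two (h : IsMDSOfDim C k) (hn : Fintype.card ι = k + 3) {i j : ι} (hij : i ≠ j)
    {z : ι → F} (hz : ({l | z l ≠ 0} : Finset ι) = {i, j}) :
    numAtDist C z 2 = #(quads C i j (z i) (z j)) + 1 := by
  have hz' : ∀ l, z l ≠ 0 ↔ l = i ∨ l = j := fun l => by
    have : l ∈ ({l | z l ≠ 0} : Finset ι) ↔ l ∈ ({i, j} : Finset ι) := by rw [hz]
    simpa using this
  have hzi : z i ≠ 0 := (hz' i).2 (Or.inl rfl)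
  have hzj : z j ≠ 0 := (hz' j).2 (Or.inr rfl)
  have h0 : (0 : ι → F) ∉ quads C i j (z i) (z j) := by simp [quads]
  rw [numAtDist_eq_card, ← card_insert_of_notMem h0]
  congr 1
  ext x
  simp only [quads, mem_filter, mem_words, mem_insert]
  constructor
  · rintro ⟨hx, hd⟩
    by_cases hx0 : x = 0
    · exact Or.inl hx0
    refine Or.inr ⟨hx, ?_⟩
    have h4 := h.lt_hammingNorm x hx hx0
    rw [hammingDist] at hd
    rw [hammingNorm] at h4 ⊢
    have hsub : ({l | x l ≠ 0} : Finset ι) ⊆ {i, j} ∪ ({l | z l ≠ x l} : Finset ι) := by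
      intro l hl
      simp only [mem_filter, mem_univ, true_and] at hl
      simp only [mem_union, mem_insert, mem_singleton, mem_filter, mem_univ, true_and, ← hz' l]
      by_cases hzl : z l = 0
      · right; rw [hzl]; exact hl.symm
      · exact Or.inl hzl
    have hc := card_le_card hsub
    have hc2 := card_union_add_card_inter {i, j} ({l | z l ≠ x l} : Finset ι)
    rw [card_pair hij, hd] at hc2
    have hint : {i, j} ∩ ({l | z l ≠ x l} : Finset ι) = ∅ := by
      rw [← card_eq_zero]; omega
    have hnot : ∀ l ∈ ({i, j} : Finset ι), x l = z l := fun l hl => by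
      by_contra hne
      have : l ∈ {i, j} ∩ ({l | z l ≠ x l} : Finset ι) := by
        rw [mem_inter]; exact ⟨hl, by simpa using Ne.symm hne⟩
      simp [hint] at this
    exact ⟨hnot i (by simp), hnot j (by simp), by omega⟩
  · rintro (rfl | ⟨hx, hxi, hxj, hx4⟩)
    · exact ⟨C.zero_mem, by rw [hammingDist_zero_right, hammingNorm, hz, card_pair hij]⟩
    · refine ⟨hx, ?_⟩
      rw [← card_support_sdiff_pair hij (hxi ▸ hzi) (hxj ▸ hzj) hx4, hammingDist]
      congr 1
      ext l
      simp only [mem_filter, mem_univ, true_and, mem_sdiff, mem_insert, mem_singleton, ← hz' l]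
      by_cases hl : z l = 0
      · simp [hl, eq_comm]
      · simp only [hl, ne_eq, not_false_eq_true, not_true_eq_false, and_false, iff_false]
        rcases (hz' l).1 hl with rfl | rfl
        · exact fun h => h hxi.symm
        · exact fun h => h hxj.symm

/-- Only distances below `3` need testing, and uniqueness of the near codeword handles all cases but
distance `2` from a vector at distance `2`, where the count is always `(k + 2) / 2`. -/
theorem isCompletelyRegular_of_codim_three (h : IsMDSOfDim C k) (hn : Fintype.card ι = k + 3)
    (hq : Fintype.card ι = Fintype.card F + 1) (heven : Even k) : IsCompletelyRegular C := by
  have key : ∀ v, distToCode C v = 2 → 2 * numAtDist C v 2 = k + 2 := by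
    intro v hv
    obtain ⟨c, hc, hcv⟩ := exists_hammingDist_eq_distToCode C v
    have hz : hammingNorm (v - c) = 2 := by rw [hammingNorm_sub, hcv, hv]
    obtain ⟨i, j, hij, hs⟩ := card_eq_two.1 hz
    have hmem : ∀ l ∈ ({i, j} : Finset ι), (v - c) l ≠ 0 := fun l hl => by
      rw [← hs] at hl
      exact (mem_filter.1 hl).2
    rw [← sub_add_cancel v c, numAtDist_add C _ hc, h.numAtDist_two hn hij hs, mul_add,
      h.two_mul_card_quads hn hq heven hij (hmem i (by simp)) (hmem j (by simp))]
  refine h.isCompletelyRegular fun u v huv t ht => ?_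
  rcases lt_or_ge t (distToCode C u) with hlt | hge
  · rw [numAtDist_eq_zero_of_lt hlt, numAtDist_eq_zero_of_lt (huv ▸ hlt)]
  by_cases h2 : distToCode C u = 2
  · obtain rfl : t = 2 := by omega
    have h3 := key u h2
    have h4 := key v (huv ▸ h2)
    omega
  · rw [h.numAtDist_eq_ite (by omega), h.numAtDist_eq_ite (by omega), huv]

/-- A two-dimensional MDS code in even characteristic extends to a hyperoval code. -/
theorem exists_distToCode_of_dim_two (h : IsMDSOfDim C 2) (heven : Even (Fintype.card F)) :
    ∃ v, Fintype.card ι - 2 ≤ distToCode C v := by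
  have hchar : ringChar F = 2 := FiniteField.even_card_iff_char_two.2 (Nat.even_iff.1 heven)
  have : CharP F 2 := ringChar.of_eq hchar
  obtain ⟨S, -, hS⟩ := exists_subset_card_eq (s := (univ : Finset ι)) (n := 2)
    (by rw [card_univ]; exact h.le_card)
  obtain ⟨i, j, hij, rfl⟩ := card_eq_two.1 hS
  obtain ⟨u, hu, huS⟩ := h.exists_mem_eqOn _ hS.le (Pi.single i 1)
  obtain ⟨w, hw, hwS⟩ := h.exists_mem_eqOn _ hS.le (Pi.single j 1)
  have hui : u i = 1 := by simpa using huS i (by simp)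
  have huj : u j = 0 := by simpa [hij.symm] using huS j (by simp)
  have hwi : w i = 0 := by simpa [hij] using hwS i (by simp)
  have hwj : w j = 1 := by simpa using hwS j (by simp)
  have hspan : ∀ x ∈ C, x = x i • u + x j • w := fun x hx =>
    h.eq_of_eqOn hx (C.add_mem (C.smul_mem _ hu) (C.smul_mem _ hw)) hS.ge fun l hl => by
      rw [mem_insert, mem_singleton] at hl
      rcases hl with rfl | rfl <;> simp [hui, huj, hwi, hwj]
  -- The points `(u l, w l, v l)` lie on the conic `XY = Z ^ 2`; square roots exist in
  -- characteristic two.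
  choose v hv using fun l => FiniteField.isSquare_of_char_two hchar (u l * w l)
  refine ⟨v, ?_⟩
  obtain ⟨x, hx, hxd⟩ := exists_hammingDist_eq_distToCode C v
  by_contra hlt
  have hA := card_agree_add_hammingDist v x
  obtain ⟨l, m, r, hl, hm, hr, hlm, hlr, hmr⟩ := two_lt_card_iff.1
    (show 2 < #({i | v i = x i} : Finset ι) by omega)
  simp only [mem_filter, mem_univ, true_and] at hl hm hr
  -- Agreement at `s` makes `(u s, w s)` a zero of one fixed binary quadratic form, which cannot
  -- have three zeros on the projective line.
  have hQ : ∀ s, v s = x s → (x i * u s + x j * w s) ^ 2 = u s * w s := fun s hs => by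
    have h1 : x s = x i * u s + x j * w s := by simpa using congrFun (hspan x hx) s
    rw [hv s, hs, h1, sq]
  have hlm2 : #({l, m} : Finset ι) = 2 := card_pair hlm
  obtain ⟨e, he, heS⟩ := h.exists_mem_eqOn _ hlm2.le (Pi.single l 1)
  obtain ⟨f, hf, hfS⟩ := h.exists_mem_eqOn _ hlm2.le (Pi.single m 1)
  have hel : e l = 1 := by simpa using heS l (by simp)
  have hem : e m = 0 := by simpa [hlm.symm] using heS m (by simp)
  have hfl : f l = 0 := by simpa [hlm] using hfS l (by simp)
  have hfm : f m = 1 := by simpa using hfS m (by simp)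
  have hspan' : ∀ x ∈ C, x = x l • e + x m • f := fun x hx =>
    h.eq_of_eqOn hx (C.add_mem (C.smul_mem _ he) (C.smul_mem _ hf)) hlm2.ge fun s hs => by
      rw [mem_insert, mem_singleton] at hs
      rcases hs with rfl | rfl <;> simp [hel, hem, hfl, hfm]
  have her : e r ≠ 0 := fun h0 => by
    have := h.eq_zero he (S := {m, r}) (card_pair hmr).ge fun s hs => by
      rw [mem_insert, mem_singleton] at hs
      rcases hs with rfl | rfl <;> assumption
    simp [this] at hel
  have hfr : f r ≠ 0 := fun h0 => by
    have := h.eq_zero hf (S := {l, r}) (card_pair hlr).ge fun s hs => by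
      rw [mem_insert, mem_singleton] at hs
      rcases hs with rfl | rfl <;> assumption
    simp [this] at hfm
  have hur : u r = u l * e r + u m * f r := by simpa using congrFun (hspan' u hu) r
  have hwr : w r = w l * e r + w m * f r := by simpa using congrFun (hspan' w hw) r
  have h2 : (2 : F) = 0 := CharTwo.two_eq_zero
  -- Column `r` is a combination of columns `l` and `m`, so three zeros of the form kill its polar
  -- form at `(l, m)`, which in characteristic two is the determinant of those columns.
  have hdet : e r * f r * (u l * w m + u m * w l) = 0 := by
    have h3 := hQ r hr
    rw [hur, hwr] at h3
    linear_combination -h3 + e r ^ 2 * hQ l hl + f r ^ 2 * hQ m hm +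
      e r * f r * (x i * u l + x j * w l) * (x i * u m + x j * w m) * h2
  have hdet' : u l * w m + u m * w l = 0 := by
    simpa [her, hfr] using hdet
  have hz := h.eq_zero (C.sub_mem (C.smul_mem (w l) hu) (C.smul_mem (u l) hw)) (S := {l, m})
    hlm2.ge fun s hs => by
      rw [mem_insert, mem_singleton] at hs
      rcases hs with rfl | rfl
      · simp; ring
      · simp
        linear_combination hdet' - u l * w s * h2
  have hwl : w l = 0 := by simpa [hui, hwi] using congrFun hz i
  have hul : u l = 0 := by simpa [huj, hwj] using congrFun hz j
  have : e l = 0 := by simpa [hwl, hul] using congrFun (hspan e he) l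
  exact one_ne_zero (hel.symm.trans this)

end IsMDSOfDim

/-! ### Correlation with dual words, without characters. -/

section Orthogonality

variable {F ι : Type*} [Field F] [Fintype F] [DecidableEq F] [Fintype ι] [DecidableEq ι]

/-- Among the vectors vanishing on `T`, a proportion `1 / q` is orthogonal to a given `y` that is
not supported on `T`. -/
theorem card_mul_card_orthogonal (T : Finset ι) {y : ι → F} {l : ι} (hl : l ∉ T) (hy : y l ≠ 0) :
    Fintype.card F * #{z : ι → F | (∀ i ∈ T, z i = 0) ∧ ∑ i, z i * y i = 0} =
      #{z : ι → F | ∀ i ∈ T, z i = 0} := by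
  rw [card_eq_sum_card_fiberwise (s := {z : ι → F | ∀ i ∈ T, z i = 0}) (t := (univ : Finset F))
    (f := fun z : ι → F => ∑ i, z i * y i) (fun _ _ => by simp),
    ← card_univ, ← smul_eq_mul, ← sum_const]
  refine sum_congr rfl fun a _ => ?_
  have hsum : ∀ (z : ι → F) (b : F), ∑ i, (z + Pi.single l b : ι → F) i * y i = ∑ i, z i * y i + b * y l := by
    intro z b
    simp only [Pi.add_apply, add_mul, sum_add_distrib, Pi.single_apply, ite_mul, zero_mul,
      sum_ite_eq', mem_univ, if_true]
  have hT : ∀ (z : ι → F) (b : F), (∀ i ∈ T, z i = 0) → ∀ i ∈ T, (z + Pi.single l b : ι → F) i = 0 := by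
    intro z b hz i hi
    have : i ≠ l := fun h => hl (h ▸ hi)
    simp [hz i hi, this]
  -- Moving the coordinate `l`, which is free because `l ∉ T`, carries the fibre over `0` onto the
  -- fibre over `a`.
  refine card_bij (fun z _ => z + Pi.single l (a / y l)) ?_
    (fun z _ z' _ h => add_left_injective _ h) ?_
  · intro z hz
    simp only [mem_filter, mem_univ, true_and] at hz ⊢
    exact ⟨hT z _ hz.1, by rw [hsum, hz.2, zero_add, div_mul_cancel₀ _ hy]⟩
  · intro z hz
    simp only [mem_filter, mem_univ, true_and] at hz
    refine ⟨z + Pi.single l (-(a / y l)), ?_, ?_⟩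
    · simp only [mem_filter, mem_univ, true_and]
      exact ⟨hT z _ hz.1, by rw [hsum, hz.2, neg_mul, div_mul_cancel₀ _ hy, add_neg_cancel]⟩
    · rw [add_assoc, ← Pi.single_add, neg_add_cancel, Pi.single_zero, add_zero]

/-- If the translates of `f` by the code sum to `1`, then `f` has no correlation with a nonzero
dual word. -/
theorem card_mul_sum_orthogonal (C : Submodule F (ι → F)) {f : (ι → F) → ℚ}
    (hf : ∀ x, ∑ c ∈ words C, f (x - c) = 1) {y : ι → F} {l : ι} (hl : y l ≠ 0)
    (hy : ∀ c ∈ C, ∑ i, c i * y i = 0) :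
    Fintype.card F * ∑ z with ∑ i, z i * y i = 0, f z = ∑ z, f z := by
  -- Summing the hypothesis over the hyperplane orthogonal to `y`, which is stable under translation
  -- by `C`; `h2` does the same over the whole space.
  have h1 : (#(words C) : ℚ) * ∑ z with ∑ i, z i * y i = 0, f z =
      #{z : ι → F | ∑ i, z i * y i = 0} := by
    have : ∑ x with ∑ i, x i * y i = 0, ∑ c ∈ words C, f (x - c) =
        #{z : ι → F | ∑ i, z i * y i = 0} := by
      rw [sum_congr rfl fun x _ => hf x, sum_const, nsmul_eq_mul, mul_one]
    rw [← this, sum_comm, ← nsmul_eq_mul, ← sum_const]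
    refine sum_congr rfl fun c hc => ?_
    rw [mem_words] at hc
    have hsub : ∀ z : ι → F, ∑ i, (z + c) i * y i = ∑ i, z i * y i := fun z => by
      simp only [Pi.add_apply, add_mul, sum_add_distrib, hy c hc, add_zero]
    refine sum_bij (fun z _ => z + c) (fun z hz => ?_) (fun z _ z' _ h => add_left_injective _ h)
      (fun z hz => ⟨z - c, ?_, sub_add_cancel z c⟩) (fun z _ => by rw [add_sub_cancel_right])
    · simp only [mem_filter, mem_univ, true_and] at hz ⊢
      rw [hsub, hz]
    · simp only [mem_filter, mem_univ, true_and] at hz ⊢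
      rw [← hsub, sub_add_cancel, hz]
  have h2 : (#(words C) : ℚ) * ∑ z, f z = Fintype.card (ι → F) := by
    have : ∑ x : ι → F, ∑ c ∈ words C, f (x - c) = Fintype.card (ι → F) := by
      rw [sum_congr rfl fun x _ => hf x, sum_const, nsmul_eq_mul, mul_one, card_univ]
    rw [← this, sum_comm, ← nsmul_eq_mul, ← sum_const]
    exact sum_congr rfl fun c _ => (Equiv.sum_comp (Equiv.subRight c) f).symm
  have h3 := card_mul_card_orthogonal (∅ : Finset ι) (notMem_empty l) hl
  simp only [notMem_empty, false_imp_iff, implies_true, true_and, filter_true, card_univ] at h3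
  have h0 : (#(words C) : ℚ) ≠ 0 := by
    have : 0 < #(words C) := card_pos.2 ⟨0, by simp⟩
    exact_mod_cast this.ne'
  apply mul_left_cancel₀ h0
  rw [h2, mul_left_comm, h1, ← h3, Nat.cast_mul]

/-- Newton expansion of a function vanishing at `0, …, k`. -/
theorem exists_newton_expansion (g : ℕ → ℚ) {k : ℕ} (hg : ∀ m ≤ k, g m = 0) :
    ∃ α : ℕ → ℚ, (∀ j ≤ k, α j = 0) ∧
      ∀ m, g m = ∑ j ∈ range (m + 1), m.choose j • α j := by
  -- The `j`-th difference at `0` involves only `g 0, …, g j`.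
  refine ⟨fun j => (fwdDiff 1)^[j] g 0, fun j hj => ?_, fun m => ?_⟩
  · simp only
    rw [fwdDiff_iter_eq_sum_shift]
    refine sum_eq_zero fun i hi => ?_
    rw [mem_range] at hi
    simp [hg i (by omega)]
  · have := shift_eq_sum_fwdDiff_iter 1 g m 0
    simpa using this

end Orthogonality

/-! ### Failure of UPWS below the maximal covering radius; extension by a vector at maximal
distance. -/

namespace IsMDSOfDim

variable {F ι : Type*} [Field F] [Fintype F] [DecidableEq F] [Fintype ι] [DecidableEq ι]
  {C : Submodule F (ι → F)} {k : ℕ}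

/-- Every set of more than `k` coordinates is the support of a dual word, if `k + 1 < q`. -/
theorem exists_dual_support (h : IsMDSOfDim C k) (hk : k + 1 < Fintype.card F) {W : Finset ι}
    (hW : k < #W) :
    ∃ y : ι → F, (∀ c ∈ C, ∑ i, c i * y i = 0) ∧ ∀ i, y i ≠ 0 ↔ i ∈ W := by
  obtain ⟨S, hSW, hS⟩ := exists_subset_card_eq hW.le
  obtain ⟨r, hrW, hrS⟩ := exists_mem_notMem_of_card_lt_card (hS ▸ hW)
  choose e he heS using fun s : ι => h.exists_mem_eqOn S hS.le (Pi.single s 1)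
  set I := (W \ S).erase r with hI
  have her : ∀ s ∈ S, e s r ≠ 0 := by
    intro s hs h0
    have hz := h.eq_zero (he s) (S := insert r (S.erase s))
      (by rw [card_insert_of_notMem (fun hr => hrS (mem_of_mem_erase hr)), card_erase_of_mem hs]
          omega)
      (fun i hi => by
        rw [mem_insert, mem_erase] at hi
        rcases hi with rfl | hi
        · exact h0
        · rw [heS s i hi.2, Pi.single_eq_of_ne hi.1])
    have := heS s s hs
    simp [hz] at this
  -- The dual word will be `1` on `I` and `c` at `r`; orthogonality then determines it on `S`. Being
  -- nonzero at each `s ∈ S` excludes one value of `c`, and so does `c ≠ 0`: at most `k + 1 < q`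
  -- values in all.
  obtain ⟨c, hc⟩ : ∃ c, c ∉ insert 0 (S.image fun s => -(∑ j ∈ I, e s j) / e s r) := by
    by_contra! hall
    have h1 := card_le_card (fun c _ => hall c : (univ : Finset F) ⊆ _)
    have h2 := card_insert_le (0 : F) (S.image fun s => -(∑ j ∈ I, e s j) / e s r)
    have h3 : #(S.image fun s => -(∑ j ∈ I, e s j) / e s r) ≤ #S := card_image_le
    rw [card_univ] at h1
    omega
  simp only [mem_insert, mem_image, not_or, not_exists, not_and] at hc
  set y : ι → F := fun l => (if l ∈ S then -(∑ j ∈ I, e l j + c * e l r) else 0) +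
    (if l = r then c else 0) + (if l ∈ I then 1 else 0) with hy
  refine ⟨y, ?_, ?_⟩
  · have hes : ∀ s ∈ S, ∑ i, e s i * y i = 0 := by
      intro s hs
      simp only [hy, mul_add, sum_add_distrib, mul_ite, mul_zero, sum_ite_eq', mem_univ, if_true,
        mul_one, sum_ite_mem, univ_inter]
      rw [sum_eq_single_of_mem s hs, heS s s hs, Pi.single_eq_same]
      · ring
      · intro l hl hls
        rw [heS s l hl, Pi.single_eq_of_ne hls, zero_mul]
    intro x hx
    have hxe : x = ∑ s ∈ S, x s • e s :=
      h.eq_of_eqOn hx (C.sum_mem fun s _ => C.smul_mem _ (he s)) hS.ge fun l hl => by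
        rw [Finset.sum_apply, sum_eq_single_of_mem l hl]
        · simp [heS l l hl]
        · intro s _ hsl
          simp [heS s l hl, hsl.symm]
    have : ∑ i, x i * y i = ∑ s ∈ S, x s * ∑ i, e s i * y i := by
      conv_lhs => rw [hxe]
      simp only [Finset.sum_apply, Pi.smul_apply, smul_eq_mul, sum_mul, mul_sum, mul_assoc]
      rw [sum_comm]
    rw [this]
    exact sum_eq_zero fun s hs => by rw [hes s hs, mul_zero]
  · intro l
    by_cases hlS : l ∈ S
    · have hlr : l ≠ r := fun hlr => hrS (hlr ▸ hlS)
      have hlI : l ∉ I := by simp [hI, hlS]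
      simp only [hy, if_pos hlS, if_neg hlr, if_neg hlI, add_zero, hSW hlS, iff_true]
      intro h0
      refine hc.2 l hlS ?_
      rw [div_eq_iff (her l hlS)]
      linear_combination h0
    by_cases hlr : l = r
    · subst hlr
      simp [hy, hlS, hI, hc.1, hrW]
    · simp [hy, hlS, hlr, hI]

theorem not_isUPWS (h : IsMDSOfDim C k) (hk : k + 1 < Fintype.card F)
    (hρ : coveringRadius C + k < Fintype.card ι) : ¬ IsUPWS C := by
  rintro ⟨β, hβ⟩
  set n := Fintype.card ι with hn
  -- Truncated at the covering radius, the weight function vanishes on vectors with at most `k`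
  -- zeros, so its Newton expansion in the number of zeros starts after order `k`.
  set β' : ℕ → ℚ := fun i => if i ∈ range (coveringRadius C + 1) then β i else 0 with hβ'
  have hf : ∀ x, ∑ c ∈ words C, β' (hammingNorm (x - c)) = 1 := by
    intro x
    simp only [hammingNorm_sub]
    rw [sum_words_hammingDist, ← hβ x]
    simp only [hβ', ite_mul, zero_mul, sum_ite_mem]
    rw [inter_eq_right.2 (range_subset_range.2 (by omega))]
  obtain ⟨α, hα, hg⟩ := exists_newton_expansion (fun m => β' (n - m)) (k := k) fun m hm => by
    simp only [hβ', mem_range]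
    rw [if_neg (by omega)]
  have hfα : ∀ z : ι → F, β' (hammingNorm z) =
      ∑ T : Finset ι, if ∀ i ∈ T, z i = 0 then α #T else 0 := by
    intro z
    have h1 := card_zeros_add_hammingNorm z
    have h2 := hg #{i | z i = 0}
    rw [← sum_powerset_apply_card, show n - #{i | z i = 0} = hammingNorm z by omega] at h2
    rw [h2, ← sum_filter]
    refine sum_congr ?_ fun _ _ => rfl
    ext T
    simp [subset_iff]
  -- Downward induction on `#W`, testing against a dual word with support `W`: larger `T ⊇ W` have
  -- zero coefficient already, and sets not containing `W` are uncorrelated with it.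
  have hzero : ∀ m, ∀ W : Finset ι, #W + m = n → α #W = 0 := by
    intro m
    induction m using Nat.strong_induction_on with
    | _ m ih =>
    intro W hW
    rcases le_or_gt #W k with hWk | hWk
    · exact hα _ hWk
    obtain ⟨y, hyC, hyW⟩ := h.exists_dual_support hk hWk
    obtain ⟨l, hlW⟩ := card_pos.1 (by omega : 0 < #W)
    have hcor := card_mul_sum_orthogonal C (f := fun z => β' (hammingNorm z)) hf ((hyW l).2 hlW) hyC
    simp only [hfα] at hcor
    rw [sum_comm, mul_sum, sum_comm (s := (univ : Finset (ι → F)))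
      (t := (univ : Finset (Finset ι)))] at hcor
    have hterm : ∀ T : Finset ι, T ≠ W →
        (Fintype.card F : ℚ) * (∑ z : ι → F with ∑ i, z i * y i = 0, if ∀ i ∈ T, z i = 0 then α #T else 0) =
          ∑ z : ι → F, if ∀ i ∈ T, z i = 0 then α #T else 0 := by
      intro T hT
      by_cases hWT : W ⊆ T
      · have hlt := card_lt_card (hWT.ssubset_of_ne hT.symm)
        have hle : #T ≤ n := card_le_univ T
        have : α #T = 0 := ih (n - #T) (by omega) T (by omega)
        simp [this]
      · obtain ⟨s, hsW, hsT⟩ := not_subset.1 hWT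
        have := card_mul_card_orthogonal T hsT ((hyW s).2 hsW)
        rw [← sum_filter, ← sum_filter, sum_const, sum_const, filter_filter, ← this, nsmul_eq_mul,
          nsmul_eq_mul, Nat.cast_mul, mul_assoc]
        simp only [and_comm]
    rw [← add_sum_erase _ _ (mem_univ W), ← add_sum_erase univ (fun T : Finset ι =>
      ∑ z : ι → F, if ∀ i ∈ T, z i = 0 then α #T else 0) (mem_univ W),
      sum_congr rfl (fun T hT => hterm T (ne_of_mem_erase hT)), add_left_inj] at hcor
    -- For `T = W` orthogonality is automatic, so the surviving term equals `q` times itself.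
    have horth : ∀ z : ι → F, (∀ i ∈ W, z i = 0) → ∑ i, z i * y i = 0 := fun z hz =>
      sum_eq_zero fun i _ => by
        by_cases hi : i ∈ W
        · rw [hz i hi, zero_mul]
        · rw [not_not.1 (mt (hyW i).1 hi), mul_zero]
    have heq : ({z : ι → F | ∑ i, z i * y i = 0 ∧ ∀ i ∈ W, z i = 0} : Finset (ι → F)) =
        ({z : ι → F | ∀ i ∈ W, z i = 0} : Finset (ι → F)) := by
      ext z
      simp only [mem_filter, mem_univ, true_and, and_iff_right_iff_imp]
      exact horth z
    rw [← sum_filter, ← sum_filter, sum_const, sum_const, filter_filter, heq, nsmul_eq_mul] at hcor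
    have hpos : (#{z : ι → F | ∀ i ∈ W, z i = 0} : ℚ) ≠ 0 := by
      have : 0 < #{z : ι → F | ∀ i ∈ W, z i = 0} := card_pos.2 ⟨0, by simp⟩
      exact_mod_cast this.ne'
    have hq1 : (Fintype.card F : ℚ) - 1 ≠ 0 := by
      rw [sub_ne_zero]
      exact_mod_cast (by omega : Fintype.card F ≠ 1)
    have : ((Fintype.card F : ℚ) - 1) * (#{z : ι → F | ∀ i ∈ W, z i = 0} * α #W) = 0 := by
      linear_combination hcor
    simpa [hq1, hpos] using this
  have h1 := hf 0
  rw [sum_eq_zero] at h1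
  · exact zero_ne_one h1
  · intro c _
    rw [hfα]
    refine sum_eq_zero fun T _ => ?_
    have hle : #T ≤ n := card_le_univ T
    rw [hzero (n - #T) T (by omega), ite_self]

/-- An MDS code with covering radius `n - k` extends to an MDS code of length `n + 1` and
dimension `k + 1`. -/
theorem exists_extension {n : ℕ} {C : Submodule F (Fin n → F)} (h : IsMDSOfDim C k)
    {v : Fin n → F} (hv : n ≤ distToCode C v + k) :
    ∃ C' : Submodule F (Fin (n + 1) → F), IsMDSOfDim C' (k + 1) := by
  let ψ : (C × F) →ₗ[F] (Fin (n + 1) → F) :=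
    { toFun := fun p => Fin.cons p.2 ((p.1 : Fin n → F) + p.2 • v)
      map_add' := fun p p' => by
        ext i
        refine Fin.cases ?_ (fun i => ?_) i
        · simp
        · simp; ring
      map_smul' := fun a p => by
        ext i
        refine Fin.cases ?_ (fun i => ?_) i
        · simp
        · simp; ring }
  have hψ : ∀ p, ψ p = Fin.cons p.2 ((p.1 : Fin n → F) + p.2 • v) := fun _ => rfl
  have hnorm : ∀ (a : F) (z : Fin n → F),
      hammingNorm (Fin.cons a z : Fin (n + 1) → F) = (if a ≠ 0 then 1 else 0) + hammingNorm z := by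
    intro a z
    rw [hammingNorm, hammingNorm, Fin.card_filter_univ_succ]
    split_ifs <;> simp_all [add_comm]
  have hinj : Function.Injective ψ := by
    rw [injective_iff_map_eq_zero]
    rintro ⟨x, a⟩ h0
    rw [hψ] at h0
    have ha : a = 0 := by simpa using congrFun h0 0
    subst ha
    have hx : (x : Fin n → F) = 0 := by
      ext i
      simpa using congrFun h0 i.succ
    simpa using hx
  refine ⟨LinearMap.range ψ, ?_, ?_⟩
  · rw [LinearMap.finrank_range_of_inj hinj, Module.finrank_prod, h.finrank_eq, Module.finrank_self]
  · rintro _ ⟨⟨x, a⟩, rfl⟩ hne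
    rw [hψ, hnorm, Fintype.card_fin]
    simp only
    by_cases ha : a = 0
    · subst ha
      have hx : (x : Fin n → F) ≠ 0 := fun hx => hne (by
        rw [show x = 0 from Subtype.ext hx]; exact map_zero ψ)
      have := h.lt_hammingNorm x x.2 hx
      rw [Fintype.card_fin] at this
      simp only [zero_smul, add_zero]
      omega
    · have hmem : -(a⁻¹ • (x : Fin n → F)) ∈ C := C.neg_mem (C.smul_mem _ x.2)
      have h1 := CodingTheory.distToCode_le C v hmem
      have h2 : hammingDist v (-(a⁻¹ • (x : Fin n → F))) = hammingNorm ((x : Fin n → F) + a • v) := by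
        rw [← hammingNorm_sub, sub_neg_eq_add,
          ← hammingNorm_smul (k := a) (fun _ => IsSMulRegular.of_ne_zero ha), smul_add,
          smul_inv_smul₀ ha, add_comm]
      rw [if_pos ha]
      omega

end IsMDSOfDim

/-! ### Doubly-extended Reed–Solomon codes are MDS. -/

section ReedSolomon

open Polynomial

variable {F ι : Type*} [Field F] [Fintype F] [DecidableEq F] [Fintype ι] {k : ℕ}

/-- A zero at `∞` means that the coefficient of degree `k - 1` vanishes, which lowers the number of
possible roots by one and compensates for the extra zero. -/
theorem card_zeros_doublyExtended_lt (e : ι ≃ Option F) {p : F[X]} (hp : p ∈ degreeLT F k)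
    (hp0 : p ≠ 0) :
    #{i | (LinearMap.pi fun i => (e i).elim (lcoeff F (k - 1)) leval : F[X] →ₗ[F] (ι → F)) p i
      = 0} < k := by
  classical
  have hdeg : p.natDegree < k := (natDegree_lt_iff_degree_lt hp0).2 (mem_degreeLT.1 hp)
  have hroots : #p.roots.toFinset ≤ p.natDegree :=
    (Multiset.toFinset_card_le _).trans (card_roots' p)
  rw [← card_map e.toEmbedding]
  by_cases hc : p.coeff (k - 1) = 0
  · have hlt : p.natDegree ≠ k - 1 := fun h => by
      rw [← h, coeff_natDegree, leadingCoeff_eq_zero] at hc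
      exact hp0 hc
    refine (card_le_card (t := insertNone p.roots.toFinset) ?_).trans_lt
      (by rw [card_insertNone]; omega)
    intro o ho
    obtain ⟨i, hi, rfl⟩ := mem_map.1 ho
    replace hi := (mem_filter.1 hi).2
    rw [LinearMap.pi_apply] at hi
    rw [Equiv.coe_toEmbedding]
    rcases hei : e i with _ | a
    · simp
    · rw [hei] at hi
      simpa [hp0] using hi
  · refine (card_le_card (t := p.roots.toFinset.map Function.Embedding.some) ?_).trans_lt
      (by rw [card_map]; omega)
    intro o ho
    obtain ⟨i, hi, rfl⟩ := mem_map.1 ho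
    replace hi := (mem_filter.1 hi).2
    rw [LinearMap.pi_apply] at hi
    rw [Equiv.coe_toEmbedding]
    rcases hei : e i with _ | a
    · rw [hei] at hi
      exact absurd hi hc
    · rw [hei] at hi
      simpa [hp0] using hi

theorem isMDSOfDim_doublyExtendedRS (e : ι ≃ Option F) (hk : k ≤ Fintype.card ι) :
    IsMDSOfDim (doublyExtendedRS e k) k := by
  set f : F[X] →ₗ[F] (ι → F) := LinearMap.pi fun i => (e i).elim (lcoeff F (k - 1)) leval with hf
  have hlt : ∀ p ∈ degreeLT F k, p ≠ 0 → #{i | f p i = 0} < k := fun p hp hp0 =>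
    card_zeros_doublyExtended_lt e hp hp0
  constructor
  · have hinj : Function.Injective (f.domRestrict (degreeLT F k)) := by
      rw [injective_iff_map_eq_zero]
      intro p hp
      by_contra hne
      have h1 := hlt p p.2 fun h0 => hne (Subtype.ext h0)
      rw [LinearMap.domRestrict_apply] at hp
      simp only [hp, Pi.zero_apply, filter_true, card_univ] at h1
      omega
    rw [doublyExtendedRS, ← hf, ← LinearMap.range_domRestrict, LinearMap.finrank_range_of_inj hinj,
      (degreeLTEquiv F k).finrank_eq, Module.finrank_fintype_fun_eq_card, Fintype.card_fin]
  · rintro _ ⟨p, hp, rfl⟩ hne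
    have h1 := hlt p hp fun h0 => hne (by rw [h0, map_zero])
    have h2 := card_zeros_add_hammingNorm (f p)
    change _ < hammingNorm (f p) + k
    omega

end ReedSolomon

end CodingTheory

/-! ### Assembly of the cases. -/

theorem mainTheorem2 (F : Type*) [Field F] [Fintype F] [DecidableEq F] (q : ℕ)
    (hq : Fintype.card F = q) :
    (∀ (k : ℕ) (C : Submodule F (Fin (q + 1) → F)),
      2 ≤ k → k ≤ (q + 1) - 2 → CodingTheory.IsLinearCode C k (q - k + 2) →
        (CodingTheory.MDSConjecture F →
          ¬ (k = q - 1 ∨ (k = 2 ∧ (Even q ∨ q = 3)) ∨ (k = q - 2 ∧ Even q)) →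
            ¬ CodingTheory.IsUPWS C ∧ ¬ CodingTheory.IsCompletelyRegular C) ∧
        (k = q - 1 →
          CodingTheory.IsHammingCode C ∧ CodingTheory.IsPerfect C ∧
            CodingTheory.IsCompletelyRegular C ∧ CodingTheory.IsUPWS C) ∧
        (k = 2 → (Even q ∨ q = 3) →
          CodingTheory.IsUPWS C ∧ (q = 3 → CodingTheory.IsCompletelyRegular C)) ∧
        (k = q - 2 → Even q → CodingTheory.IsUPWS C)) ∧
    (∀ m : ℕ, 1 < m → q = 2 ^ m →
      ∃ D : Submodule F (Fin (q + 1) → F),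
        CodingTheory.IsLinearCode D (q - 2) 4 ∧ CodingTheory.IsCompletelyRegular D ∧
          ∃ e : Fin (q + 1) ≃ Option F, D = CodingTheory.doublyExtendedRS e (q - 2)) := by
  have hcard : Fintype.card (Fin (q + 1)) = q + 1 := Fintype.card_fin _
  constructor
  · intro k C hk2 hkq hC
    have h : CodingTheory.IsMDSOfDim C k := hC.isMDSOfDim (by omega)
    refine ⟨fun hconj hk => ?_, fun hk => ?_, fun hk hq' => ?_, fun hk heven => ?_⟩
    · have hnot : ¬ CodingTheory.IsUPWS C := by
        refine h.not_isUPWS (by omega) ?_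
        by_contra hρ
        obtain ⟨v, hv⟩ : ∃ v, q + 1 ≤ CodingTheory.distToCode C v + k := by
          by_contra! hall
          have := CodingTheory.coveringRadius_le (C := C) (r := q - k) fun v => by
            have := hall v
            omega
          omega
        obtain ⟨C', h'⟩ := h.exists_extension hv
        have hMDS : CodingTheory.IsMDS C' := by
          rw [CodingTheory.IsMDS, h'.finrank_eq, h'.minDist_eq (Nat.succ_pos k)]
        have := hconj (q + 1 + 1) (k + 1) C' h'.finrank_eq hMDS (by omega) (by omega)
        rw [hq] at this
        -- The extended code has dimension `k + 1`, so the exceptions `3` and `q - 1` of the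
        -- conjecture become `k = 2` and `k = q - 2`.
        rcases this with hle | ⟨heven, h3 | h3, -⟩
        · omega
        · exact hk (Or.inr (Or.inl ⟨by omega, Or.inl heven⟩))
        · exact hk (Or.inr (Or.inr ⟨by omega, heven⟩))
      exact ⟨hnot, fun hCR => hnot hCR.isUPWS⟩
    · have hCR := h.isCompletelyRegular_of_codim_two (by omega) (by omega)
      exact ⟨h.isHammingCode (by omega) (by omega), h.isPerfect (by omega) (by omega) (by omega),
        hCR, hCR.isUPWS⟩
    · have hq3 : q = 3 → CodingTheory.IsCompletelyRegular C := fun hq3 =>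
        h.isCompletelyRegular_of_codim_two (by omega) (by omega)
      refine ⟨?_, hq3⟩
      rcases hq' with heven | h3
      · subst hk
        obtain ⟨v, hv⟩ := h.exists_distToCode_of_dim_two (by rwa [hq])
        exact h.isUPWS (hv.trans (CodingTheory.distToCode_le_coveringRadius C v))
      · exact (hq3 h3).isUPWS
    · refine (h.isCompletelyRegular_of_codim_three (by omega) (by omega) ?_).isUPWS
      rw [hk]
      exact heven.tsub even_two
  · intro m hm hqm
    have hq4 : 4 ≤ q := by
      rw [hqm]
      exact Nat.pow_le_pow_right two_pos hm
    have heven : Even q := by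
      rw [hqm]
      exact even_two.pow_of_ne_zero (by omega)
    have e : Fin (q + 1) ≃ Option F :=
      Fintype.equivOfCardEq (by rw [hcard, Fintype.card_option, hq])
    have h := CodingTheory.isMDSOfDim_doublyExtendedRS e (k := q - 2) (by omega)
    refine ⟨CodingTheory.doublyExtendedRS e (q - 2), ?_, ?_, e, rfl⟩
    · have := h.isLinearCode (by omega)
      rwa [hcard, show q + 1 - (q - 2) + 1 = 4 by omega] at this
    · exact h.isCompletelyRegular_of_codim_three (by omega) (by omega) (heven.tsub even_two)
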